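/- There is an absolute constant $C>0$ such that the following holds. Let $Y$ be any set and let $S:[0,1]\times Y\to\mathbb R$ be a scoring function such that, for every $y\in Y$, the function $p\mapsto S(p,y)$ is convex and $1$-Lipschitz on $[0,1]$. For predictions $p_1,\dots,p_T\in[0,1]$ and outcomes $y_1,\dots,y_T\in Y$ define the calibration error \[ \mathsf{CAL}_S(p_{1:T};y_{1:T})=\sum_{p\in\{p_1,\dots,p_T\}} n_p\Big(\mathbb E_{y\sim\tau_p}S(p,y)-\inf_{p^*\in[0,1]}\mathbb E_{y\sim\tau_p}S(p^*,y)\Big), \] where $n_p=|\{t: p_t=p\}|$ and $\tau_p$ is the distribution of $y_t$ for $t$ uniform in $\{t:p_t=p\}$. Consider the $T$-round game in which, in round $t$, the predictor chooses a distribution $\rho_t$ on $[0,1]$ depending on the past transcript $(p_1,y_1,\dots,p_{t-1},y_{t-1})$; an adversary, who knows the predictor's strategy and the past transcript but not $p_t$, chooses $y_t\in Y$; and $p_t$ is drawn from $\rho_t$. Then for every integer $T\ge 2$ there is a randomized prediction strategy (which may depend on $S$ and $T$) such that, against every adaptive adversary, \[ \mathbb E\big[\mathsf{CAL}_S(p_{1:T};y_{1:T})\big]\le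 C\sqrt T\,\log T . \] In particular, with $Y=[0,1]$, for every $T\ge2$ there are randomized prediction strategies with this guarantee for median calibration, $S(p,y)=|p-y|$, and, for every $q\in[0,1]$, for $q$-quantile calibration, $S(p,y)=\mathbb I[y\ge p]\,q\,(y-p)+\mathbb I[y\le p]\,(1-q)\,(p-y)$. -/

import Mathlib

noncomputable section

/-- The expectation `E_{x ∼ τ} f x` of a real function under a discrete distribution. -/
def PMFExpect {α : Type*} (τ : PMF α) (f : α → ℝ) : ℝ :=
  ∑' x, (τ x).toReal * f x

/-! ### Scoring functions and calibration error

A scoring function on `[0,1] × Y` is represented by `S : ℝ → Y → ℝ`; only its values `S p y` with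
`p ∈ [0,1]` are ever used. -/

/-- The score `S p y` is a convex and `1`-Lipschitz function of `p ∈ [0,1]` for every `y`. -/
def IsConvexLipschitzScore {Y : Type*} (S : ℝ → Y → ℝ) : Prop :=
  ∀ y : Y, ConvexOn ℝ (Set.Icc (0 : ℝ) 1) (fun p => S p y) ∧
    LipschitzOnWith 1 (fun p => S p y) (Set.Icc (0 : ℝ) 1)

/-- The sub-optimality of the report `p` with respect to the distribution `τ` of the outcome. -/
def subopt {Y : Type*} (S : ℝ → Y → ℝ) (τ : PMF Y) (p : unitInterval) : ℝ :=
  PMFExpect τ (fun y => S p y) - ⨅ r : unitInterval, PMFExpect τ (fun y => S r y)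

/-- The set of rounds in which the prediction equals `q`. -/
def roundsWith {T : ℕ} (p : Fin T → unitInterval) (q : unitInterval) : Finset (Fin T) :=
  Finset.univ.filter (fun t => p t = q)

theorem roundsWith_nonempty {T : ℕ} (p : Fin T → unitInterval) {q : unitInterval}
    (hq : q ∈ Finset.univ.image p) : (roundsWith p q).Nonempty := by
  obtain ⟨t, -, ht⟩ := Finset.mem_image.1 hq
  exact ⟨t, by simp [roundsWith, ht]⟩

/-- The distribution of the outcome `y t` when `t` is sampled uniformly from the rounds in which
the prediction equals `q`. -/
def outcomeDist {Y : Type*} {T : ℕ} (p : Fin T → unitInterval) (y : Fin T → Y)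
    (q : unitInterval) (hq : q ∈ Finset.univ.image p) : PMF Y :=
  (PMF.uniformOfFinset (roundsWith p q) (roundsWith_nonempty p hq)).map y

/-- The calibration error: the sum, over the distinct predictions `q`, of the number of rounds in
which `q` is predicted times the sub-optimality of `q` for the outcomes of these rounds. -/
def CAL {Y : Type*} (S : ℝ → Y → ℝ) {T : ℕ} (p : Fin T → unitInterval) (y : Fin T → Y) : ℝ :=
  ∑ q ∈ (Finset.univ.image p).attach,
    ((roundsWith p q.1).card : ℝ) * subopt S (outcomeDist p y q.1 q.2) q.1

/-- The scoring function that elicits the median. -/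
def medianScore (p : ℝ) (y : unitInterval) : ℝ := |p - y|

/-- The scoring function that elicits the `q`-quantile. -/
def quantileScore (q : ℝ) (p : ℝ) (y : unitInterval) : ℝ :=
  (if p ≤ (y : ℝ) then q * ((y : ℝ) - p) else 0) +
    (if (y : ℝ) ≤ p then (1 - q) * (p - (y : ℝ)) else 0)

/-! ### The prediction game -/

/-- The predictions and outcomes of the first `t` rounds. -/
abbrev Transcript (Y : Type*) (t : ℕ) := Fin t → unitInterval × Y

/-- A randomized prediction strategy: after `t` rounds it chooses, from the transcript so far, the
distribution on `[0,1]` from which the next prediction is drawn. -/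
abbrev PredictionStrategy (Y : Type*) := (t : ℕ) → Transcript Y t → PMF unitInterval

/-- An adaptive adversary: after `t` rounds it chooses, from the transcript so far but without
seeing the next prediction, the next outcome. -/
abbrev Adversary (Y : Type*) := (t : ℕ) → Transcript Y t → Y

/-- The law of the transcript of the first `t` rounds of the game. -/
def transcriptLaw {Y : Type*} (ρ : PredictionStrategy Y) (A : Adversary Y) :
    (t : ℕ) → PMF (Transcript Y t)
  | 0 => PMF.pure (fun i => i.elim0)
  | t + 1 => (transcriptLaw ρ A t).bind fun h =>
      (ρ t h).map fun p => Fin.snoc (α := fun _ => unitInterval × Y) h (p, A t h)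

/-- The calibration error of a transcript. -/
def transcriptCAL {Y : Type*} (S : ℝ → Y → ℝ) {T : ℕ} (h : Transcript Y T) : ℝ :=
  CAL S (fun t => (h t).1) (fun t => (h t).2)

/-- The strategy `ρ` guarantees that the expected calibration error after `T` rounds exists and is
at most `B`, whatever the adaptive adversary does. -/
def GuaranteesCAL {Y : Type*} (S : ℝ → Y → ℝ) (T : ℕ) (ρ : PredictionStrategy Y) (B : ℝ) : Prop :=
  ∀ A : Adversary Y,
    Summable (fun h : Transcript Y T => (transcriptLaw ρ A T h).toReal * transcriptCAL S h) ∧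
      PMFExpect (transcriptLaw ρ A T) (transcriptCAL S) ≤ B

end

/-!
The predictor plays on the grid `{q / n}` with `n = 2 ^ K` of order `√T`, which costs at most `1` in
regret per `n` rounds. The regret of `q / n` against `m / n` is `1 / n` times a sum over the cells
between them of the slopes of the score, with a sign. An index `q` is given the width
`w = gcd (q, n)`. On each cell, the signed slopes over the rounds in which `q` was predicted are
summed, compensated by `O (1 / w)` per round on the cells within `4 * w` of `q`, and tracked by an
exponential weight with learning rate `1 / (2 * w)`.

Every nondecreasing vector of slopes bounded by `1` has a good response: an index `q` whose signed
slopes are at most `1 / w` within `4 * w` of `q` and at most `-1 / (2 * w)` elsewhere. To find it,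
take the last scale `w = 2 ^ v` at which the slopes of size at most `1 / w` fill an interval of
length `2 * w`; such an interval contains an index of width exactly `w`. Predicting a good response
does not increase the total weight, even when the exponentials are replaced by majorants affine in
the slopes, so by the minimax theorem some distribution on the grid keeps the total weight from
increasing in expectation whatever the outcome.

The calibration error is at most `13 * T / n` plus the final total weight, whose expectation is
bounded by its initial value `2 * ∑ q, gcd (q, n)`. Each of the `K + 1` divisors of `n` contributes
at most `n` to this sum, so the bound is `O (T / n + n * K) = O (√T * log T)`.
-/

/-! ### Finitely supported expectations -/

section Expectation

variable {α β : Type*} {τ : PMF α}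

theorem PMFExpect_eq_sum {s : Finset α} (hs : τ.support ⊆ s) (f : α → ℝ) :
    PMFExpect τ f = ∑ x ∈ s, (τ x).toReal * f x :=
  tsum_eq_sum fun x hx => by simp [(τ.apply_eq_zero_iff x).2 fun h => hx (hs h)]

theorem summable_toReal_mul_of_finite_support (hτ : τ.support.Finite) (f : α → ℝ) :
    Summable fun x => (τ x).toReal * f x :=
  summable_of_ne_finset_zero (s := hτ.toFinset) fun x hx => by
    simp [(τ.apply_eq_zero_iff x).2 fun h => hx (hτ.mem_toFinset.2 h)]

theorem sum_toReal_eq_one {s : Finset α} (hs : τ.support ⊆ s) : ∑ x ∈ s, (τ x).toReal = 1 := by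
  rw [← ENNReal.toReal_sum fun x _ => τ.apply_ne_top x, ← ENNReal.toReal_one, ← τ.tsum_coe]
  congr 1
  exact (tsum_eq_sum fun x hx => (τ.apply_eq_zero_iff x).2 fun h => hx (hs h)).symm

theorem PMFExpect_mono (hτ : τ.support.Finite) {f g : α → ℝ} (h : ∀ x ∈ τ.support, f x ≤ g x) :
    PMFExpect τ f ≤ PMFExpect τ g := by
  rw [PMFExpect_eq_sum hτ.coe_toFinset.ge, PMFExpect_eq_sum hτ.coe_toFinset.ge]
  exact Finset.sum_le_sum fun x hx =>
    mul_le_mul_of_nonneg_left (h x (hτ.mem_toFinset.1 hx)) ENNReal.toReal_nonneg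

theorem PMFExpect_const_add (hτ : τ.support.Finite) (c : ℝ) (f : α → ℝ) :
    PMFExpect τ (fun x => c + f x) = c + PMFExpect τ f := by
  rw [PMFExpect_eq_sum hτ.coe_toFinset.ge, PMFExpect_eq_sum hτ.coe_toFinset.ge]
  simp only [mul_add, Finset.sum_add_distrib]
  rw [← Finset.sum_mul, sum_toReal_eq_one hτ.coe_toFinset.ge, one_mul]

theorem PMFExpect_pure (a : α) (f : α → ℝ) : PMFExpect (PMF.pure a) f = f a := by
  rw [PMFExpect_eq_sum (s := {a}) (by simp)]
  simp

theorem finite_support_bind {g : α → PMF β} (hτ : τ.support.Finite)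
    (hg : ∀ a, (g a).support.Finite) : (τ.bind g).support.Finite := by
  rw [PMF.support_bind]
  exact hτ.biUnion fun a _ => hg a

theorem toReal_bind_apply {s : Finset α} (hs : τ.support ⊆ s) (g : α → PMF β) (b : β) :
    (τ.bind g b).toReal = ∑ a ∈ s, (τ a).toReal * (g a b).toReal := by
  rw [PMF.bind_apply, tsum_eq_sum (s := s) fun a ha => by
    simp [(τ.apply_eq_zero_iff a).2 fun h => ha (hs h)]]
  rw [ENNReal.toReal_sum fun a _ => ENNReal.mul_ne_top (τ.apply_ne_top a) ((g a).apply_ne_top b)]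
  simp only [ENNReal.toReal_mul]

theorem PMFExpect_bind {g : α → PMF β} (hτ : τ.support.Finite)
    (hg : ∀ a, (g a).support.Finite) (f : β → ℝ) :
    PMFExpect (τ.bind g) f = PMFExpect τ fun a => PMFExpect (g a) f := by
  have hbind := finite_support_bind hτ hg
  have hsub : ∀ a ∈ hτ.toFinset, (g a).support ⊆ hbind.toFinset := fun a ha b hb =>
    hbind.mem_toFinset.2 ((PMF.mem_support_bind_iff _ _ _).2 ⟨a, hτ.mem_toFinset.1 ha, hb⟩)
  rw [PMFExpect_eq_sum hτ.coe_toFinset.ge, PMFExpect_eq_sum hbind.coe_toFinset.ge]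
  simp only [toReal_bind_apply hτ.coe_toFinset.ge, Finset.sum_mul]
  rw [Finset.sum_comm]
  refine Finset.sum_congr rfl fun a ha => ?_
  simp only [PMFExpect_eq_sum (hsub a ha), Finset.mul_sum, mul_assoc]

theorem PMFExpect_map (g : α → β) (hτ : τ.support.Finite) (f : β → ℝ) :
    PMFExpect (τ.map g) f = PMFExpect τ (f ∘ g) := by
  rw [← PMF.bind_pure_comp, PMFExpect_bind hτ fun a => by simp]
  simp only [Function.comp_def, PMFExpect_pure]

/-- The probability distribution on `ι` given by a point of the standard simplex. -/
noncomputable def simplexPMF {ι : Type*} [Fintype ι] (ρ : ι → ℝ) (hρ : ρ ∈ stdSimplex ℝ ι) :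
    PMF ι :=
  PMF.ofFintype (fun i => ENNReal.ofReal (ρ i)) <| by
    rw [← ENNReal.ofReal_sum_of_nonneg fun i _ => hρ.1 i, hρ.2, ENNReal.ofReal_one]

theorem PMFExpect_simplexPMF {ι : Type*} [Fintype ι] {ρ : ι → ℝ} (hρ : ρ ∈ stdSimplex ℝ ι)
    (f : ι → ℝ) : PMFExpect (simplexPMF ρ hρ) f = ∑ i, ρ i * f i := by
  rw [PMFExpect_eq_sum (s := Finset.univ) (by simp)]
  simp only [simplexPMF, PMF.ofFintype_apply, ENNReal.toReal_ofReal (hρ.1 _)]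

end Expectation

/-! ### Minimax and monotone slopes -/

section Minimax

variable {E ι : Type*} [AddCommGroup E] [Module ℝ E] {D : Set E}

theorem concaveOn_sum_mul [Fintype ι] {L : E → ι → ℝ} (hD : Convex ℝ D)
    (hL : ∀ i, ConcaveOn ℝ D fun d => L d i) {ρ : ι → ℝ} (hρ : ∀ i, 0 ≤ ρ i) :
    ConcaveOn ℝ D fun d => ∑ i, ρ i * L d i := by
  refine ⟨hD, fun d hd e he a b ha hb hab => ?_⟩
  simp only [smul_eq_mul, Finset.mul_sum, ← Finset.sum_add_distrib]
  refine Finset.sum_le_sum fun i _ => ?_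
  have hi := mul_le_mul_of_nonneg_left ((hL i).2 hd he ha hb hab) (hρ i)
  simp only [smul_eq_mul] at hi
  linarith

variable [TopologicalSpace E] [IsTopologicalAddGroup E] [ContinuousSMul ℝ E]

theorem exists_stdSimplex_sum_mul_nonpos [Fintype ι] (hDc : IsCompact D) (hD : Convex ℝ D)
    (hne : D.Nonempty) {L : E → ι → ℝ} (hcont : ∀ i, ContinuousOn (fun d => L d i) D)
    (hL : ∀ i, ConcaveOn ℝ D fun d => L d i) (hresp : ∀ d ∈ D, ∃ i, L d i ≤ 0) :
    ∃ ρ ∈ stdSimplex ℝ ι, ∀ d ∈ D, ∑ i, ρ i * L d i ≤ 0 := by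
  classical
  obtain ⟨i₀, -⟩ := hresp _ hne.choose_spec
  have hlin : ∀ d, ConvexOn ℝ (stdSimplex ℝ ι) fun ρ => ∑ i, ρ i * L d i := fun d =>
    (LinearMap.convexOn (∑ i, L d i • LinearMap.proj i) (convex_stdSimplex ℝ ι)).congr
      fun ρ _ => by simp [mul_comm]
  obtain ⟨ρ, hρ, d₀, hd₀, hsaddle⟩ := Sion.exists_isSaddlePointOn
    (f := fun (ρ : ι → ℝ) d => ∑ i, ρ i * L d i)
    ⟨_, single_mem_stdSimplex ℝ i₀⟩ (convex_stdSimplex ℝ ι) (isCompact_stdSimplex ℝ ι)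
    (fun d _ => ContinuousOn.lowerSemicontinuousOn (by fun_prop))
    (fun d _ => (hlin d).quasiconvexOn)
    hD hne hDc
    (fun ρ _ => (continuousOn_finsetSum _ fun i _ =>
      continuousOn_const.mul (hcont i)).upperSemicontinuousOn)
    (fun ρ hρ => (concaveOn_sum_mul hD hL hρ.1).quasiconcaveOn)
  refine ⟨ρ, hρ, fun d hd => ?_⟩
  obtain ⟨i, hi⟩ := hresp d₀ hd₀
  calc ∑ j, ρ j * L d j ≤ ∑ j, (Pi.single i 1 : ι → ℝ) j * L d₀ j :=
        hsaddle _ (single_mem_stdSimplex ℝ i) d hd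
    _ = L d₀ i := by simp [Pi.single_apply]
    _ ≤ 0 := hi

end Minimax

/-- The set of nondecreasing vectors of slopes bounded by `1`, as produced by a convex
`1`-Lipschitz function on the `n` cells of a uniform grid. -/
def slopeSet (n : ℕ) : Set (Fin n → ℝ) := {d | Monotone d ∧ ‖d‖ ≤ 1}

theorem abs_le_one_of_mem_slopeSet {n : ℕ} {d : Fin n → ℝ} (hd : d ∈ slopeSet n) (j : Fin n) :
    |d j| ≤ 1 :=
  (norm_le_pi_norm d j).trans hd.2

theorem slopeSet_nonempty (n : ℕ) : (slopeSet n).Nonempty := ⟨0, monotone_const, by simp⟩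

theorem convex_slopeSet (n : ℕ) : Convex ℝ (slopeSet n) := by
  refine fun d hd e he a b ha hb hab => ⟨(hd.1.const_smul ha).add (he.1.const_smul hb), ?_⟩
  exact mem_closedBall_zero_iff.1 <| convex_closedBall (0 : Fin n → ℝ) 1
    (mem_closedBall_zero_iff.2 hd.2) (mem_closedBall_zero_iff.2 he.2) ha hb hab

theorem isCompact_slopeSet (n : ℕ) : IsCompact (slopeSet n) := by
  have : slopeSet n = {d | Monotone d} ∩ Metric.closedBall 0 1 := by
    ext d
    simp [slopeSet]
  rw [this]
  exact (isCompact_closedBall _ _).inter_left isClosed_monotone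

/-! ### Good responses on the dyadic grid -/

/-- The width of the grid index `q`, the largest divisor of `n` of which `q` is a multiple; the
index `0` has width `n`. Around `q`, losses are tolerated on a region of about this width. -/
def gridWidth {n : ℕ} (q : Fin n) : ℕ := (q : ℕ).gcd n

theorem gridWidth_pos {n : ℕ} (q : Fin n) : 0 < gridWidth q := Nat.gcd_pos_of_pos_right _ q.pos

theorem sum_gcd_le (n : ℕ) : ∑ q ∈ Finset.range n, q.gcd n ≤ n * n.divisors.card := by
  rcases n.eq_zero_or_pos with rfl | hn
  · simp
  have hmaps : ∀ q ∈ Finset.range n, q.gcd n ∈ n.divisors := fun q _ =>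
    Nat.mem_divisors.2 ⟨Nat.gcd_dvd_right q n, hn.ne'⟩
  rw [← Finset.sum_fiberwise_of_maps_to hmaps, mul_comm, ← smul_eq_mul]
  refine Finset.sum_le_card_nsmul _ _ _ fun d hd => ?_
  have hdn := (Nat.mem_divisors.1 hd).1
  calc ∑ q ∈ Finset.range n with q.gcd n = d, q.gcd n
      = ((Finset.range n).filter fun q => n.gcd q = d).card * d := by
        simp only [Nat.gcd_comm n]
        exact Finset.sum_const_nat fun q hq => (Finset.mem_filter.1 hq).2
    _ = (n / d).totient * d := by rw [Nat.totient_div_of_dvd hdn]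
    _ ≤ n / d * d := Nat.mul_le_mul_right _ (Nat.totient_le _)
    _ = n := Nat.div_mul_cancel hdn

theorem sum_gridWidth_two_pow_le (K : ℕ) :
    ∑ q : Fin (2 ^ K), gridWidth q ≤ (K + 1) * 2 ^ K := by
  have := sum_gcd_le (2 ^ K)
  rw [Nat.divisors_prime_pow Nat.prime_two, Finset.card_map, Finset.card_range] at this
  rw [mul_comm]
  simpa only [gridWidth, Fin.sum_univ_eq_sum_range fun q => q.gcd (2 ^ K)] using this

theorem exists_gridWidth_eq_two_pow {K v c : ℕ} (hv : v < K) (hc : c + 2 * 2 ^ v ≤ 2 ^ K) :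
    ∃ q : Fin (2 ^ K), c ≤ q ∧ (q : ℕ) < c + 2 * 2 ^ v ∧ gridWidth q = 2 ^ v := by
  have hw : 0 < 2 ^ v := by positivity
  set i := (c + 2 ^ v - 1) / (2 * 2 ^ v)
  have hdiv : 2 * 2 ^ v * i + (c + 2 ^ v - 1) % (2 * 2 ^ v) = c + 2 ^ v - 1 := Nat.div_add_mod _ _
  have hmod : (c + 2 ^ v - 1) % (2 * 2 ^ v) < 2 * 2 ^ v := Nat.mod_lt _ (by omega)
  have hq : 2 ^ v * (2 * i + 1) = 2 * 2 ^ v * i + 2 ^ v := by ring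
  refine ⟨⟨2 ^ v * (2 * i + 1), by omega⟩, by simp only; omega, by simp only; omega, ?_⟩
  have hcop : (2 * i + 1).Coprime (2 ^ (K - v)) := Nat.Coprime.pow_right _ (by simp)
  have hK : 2 ^ K = 2 ^ v * 2 ^ (K - v) := by rw [← pow_add, Nat.add_sub_of_le hv.le]
  calc (2 ^ v * (2 * i + 1)).gcd (2 ^ K) = 2 ^ v * (2 * i + 1).gcd (2 ^ (K - v)) := by
        rw [hK, Nat.gcd_mul_left]
    _ = 2 ^ v := by rw [hcop, mul_one]

/-- The sign with which a slope at the cell `j` enters the regret of the grid index `q` against a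
grid index on the other side of that cell: the cell `j` lies to the right of `q` if `q ≤ j`. -/
noncomputable def slopeSign {n : ℕ} (q j : Fin n) : ℝ := if q ≤ j then -1 else 1

theorem abs_slopeSign {n : ℕ} (q j : Fin n) : |slopeSign q j| = 1 := by
  unfold slopeSign
  split_ifs <;> simp

/-- The learning rate of the exponential weights attached to the grid index `q`. -/
noncomputable def gridRate {n : ℕ} (q : Fin n) : ℝ := 1 / (2 * gridWidth q)

theorem gridRate_pos {n : ℕ} (q : Fin n) : 0 < gridRate q := by
  have := gridWidth_pos q
  unfold gridRate
  positivity

theorem gridRate_le_one {n : ℕ} (q : Fin n) : gridRate q ≤ 1 := by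
  have : (1 : ℝ) ≤ gridWidth q := by exact_mod_cast gridWidth_pos q
  exact div_le_one_of_le₀ (by linarith) (by linarith)

/-- The cells at distance at most `4 * gridWidth q` from the grid index `q`. -/
def window {n : ℕ} (q : Fin n) : Finset (Fin n) :=
  {j | (q : ℕ) ≤ j + 4 * gridWidth q ∧ (j : ℕ) < q + 4 * gridWidth q}

theorem card_window_le {n : ℕ} (q : Fin n) : (window q).card ≤ 8 * gridWidth q := by
  have hsub : (window q).map Fin.valEmbedding ⊆
      Finset.Ico ((q : ℕ) - 4 * gridWidth q) (q + 4 * gridWidth q) := by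
    intro i hi
    obtain ⟨j, hj, rfl⟩ := Finset.mem_map.1 hi
    obtain ⟨-, h₁, h₂⟩ := Finset.mem_filter.1 hj
    exact Finset.mem_Ico.2 ⟨Nat.sub_le_iff_le_add.2 h₁, h₂⟩
  have := Finset.card_le_card hsub
  rw [Finset.card_map, Nat.card_Ico] at this
  omega

/-- The grid index `q` is a good response to the slopes `d`: the cells outside its window push the
exponential potential down, and those inside it push it up only by a quadratic amount. -/
def IsGoodResponse {n : ℕ} (d : Fin n → ℝ) (q : Fin n) : Prop :=
  ∀ j, slopeSign q j * d j ≤ if j ∈ window q then 2 * gridRate q else -gridRate q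

theorem isGoodResponse_of_monotone {n : ℕ} {d : Fin n → ℝ} (hd : Monotone d) {q : Fin n}
    (hq : |d q| ≤ 2 * gridRate q)
    (hleft : ∀ j : Fin n, (j : ℕ) + 4 * gridWidth q < q → d j < -gridRate q)
    (hright : ∀ j : Fin n, (q : ℕ) + 4 * gridWidth q ≤ j → gridRate q < d j) :
    IsGoodResponse d q := by
  intro j
  obtain ⟨hq₁, hq₂⟩ := abs_le.1 hq
  unfold slopeSign
  split_ifs with hle hwin hwin
  · linarith [hd hle]
  · have : (q : ℕ) + 4 * gridWidth q ≤ j := by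
      have : (q : ℕ) ≤ j := hle
      simp only [window, Finset.mem_filter_univ] at hwin
      omega
    linarith [hright j this]
  · linarith [hd (not_le.1 hle).le]
  · have : (j : ℕ) + 4 * gridWidth q < q := by
      have : (j : ℕ) < q := not_le.1 hle
      simp only [window, Finset.mem_filter_univ] at hwin
      omega
    linarith [hleft j this]

theorem lt_card_filter_iff_of_antitone {n : ℕ} {P : Fin n → Prop} [DecidablePred P]
    (hP : Antitone P) (j : Fin n) : (j : ℕ) < Finset.card {i | P i} ↔ P j := by
  constructor
  · intro hj
    by_contra hPj
    have hsub : ({i | P i} : Finset (Fin n)) ⊆ Finset.Iio j := fun i hi =>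
      Finset.mem_Iio.2 <| not_le.1 fun hji => hPj (hP hji (Finset.mem_filter.1 hi).2)
    have := Finset.card_le_card hsub
    rw [Fin.card_Iio] at this
    omega
  · intro hPj
    have hsub : Finset.Iic j ⊆ ({i | P i} : Finset (Fin n)) := fun i hi =>
      Finset.mem_filter_univ i |>.2 (hP (Finset.mem_Iic.1 hi) hPj)
    have := Finset.card_le_card hsub
    rw [Fin.card_Iic] at this
    omega

/-- The number of cells with slope less than `x`: when the slopes increase, the index of the first
cell with slope at least `x`. -/
noncomputable def numSlopesLT {n : ℕ} (d : Fin n → ℝ) (x : ℝ) : ℕ := Finset.card {j | d j < x}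

/-- The number of cells with slope at most `x`: when the slopes increase, the index of the first
cell with slope greater than `x`. -/
noncomputable def numSlopesLE {n : ℕ} (d : Fin n → ℝ) (x : ℝ) : ℕ := Finset.card {j | d j ≤ x}

section NumSlopes

variable {n : ℕ} {d : Fin n → ℝ}

theorem lt_numSlopesLT_iff (hd : Monotone d) {x : ℝ} {j : Fin n} :
    (j : ℕ) < numSlopesLT d x ↔ d j < x :=
  lt_card_filter_iff_of_antitone (fun _ _ hij h => (hd hij).trans_lt h) j

theorem lt_numSlopesLE_iff (hd : Monotone d) {x : ℝ} {j : Fin n} :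
    (j : ℕ) < numSlopesLE d x ↔ d j ≤ x :=
  lt_card_filter_iff_of_antitone (fun _ _ hij h => (hd hij).trans h) j

theorem monotone_numSlopesLT (d : Fin n → ℝ) : Monotone (numSlopesLT d) := fun _ _ hxy =>
  Finset.card_le_card <| Finset.monotone_filter_right _ fun _ _ hj => lt_of_lt_of_le hj hxy

theorem monotone_numSlopesLE (d : Fin n → ℝ) : Monotone (numSlopesLE d) := fun _ _ hxy =>
  Finset.card_le_card <| Finset.monotone_filter_right _ fun _ _ hj => le_trans hj hxy

theorem numSlopesLE_le (d : Fin n → ℝ) (x : ℝ) : numSlopesLE d x ≤ n :=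
  (Finset.card_filter_le _ _).trans (by simp)

theorem numSlopesLT_neg_one (hd : d ∈ slopeSet n) : numSlopesLT d (-1) = 0 := by
  simpa [numSlopesLT, Finset.filter_eq_empty_iff] using
    fun j => (abs_le.1 (abs_le_one_of_mem_slopeSet hd j)).1

theorem numSlopesLE_one (hd : d ∈ slopeSet n) : numSlopesLE d 1 = n := by
  simp [numSlopesLE,
    Finset.filter_true_of_mem fun j _ => (abs_le.1 (abs_le_one_of_mem_slopeSet hd j)).2]

end NumSlopes

theorem exists_last_scale {K : ℕ} {a b : ℕ → ℕ} (h₀ : a 0 + 2 ≤ b 0)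
    (hK : b K < a K + 2 * 2 ^ K) :
    ∃ v < K, a v + 2 * 2 ^ v ≤ b v ∧ b (v + 1) < a (v + 1) + 2 * 2 ^ (v + 1) := by
  by_contra! h
  have hall : ∀ v ≤ K, a v + 2 * 2 ^ v ≤ b v := by
    intro v hv
    induction v with
    | zero => simpa using h₀
    | succ v ih => exact h v hv (ih (by omega))
  exact (hall K le_rfl).not_gt hK

/-- The slopes of size at most `2 ^ (-v)` fill an interval long enough to contain an index of width
`2 ^ v`. Those of size at most `2 ^ (-v - 1)` fill less than four such widths, so they lie in the
window of an index chosen next to them. -/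
theorem exists_isGoodResponse_of_scale {K v : ℕ} (hvK : v < K) {d : Fin (2 ^ K) → ℝ}
    (hd : Monotone d) (hv : numSlopesLT d (-(1 / 2 ^ v)) + 2 * 2 ^ v ≤ numSlopesLE d (1 / 2 ^ v))
    (hv' : numSlopesLE d (1 / 2 ^ (v + 1)) <
      numSlopesLT d (-(1 / 2 ^ (v + 1))) + 2 * 2 ^ (v + 1)) :
    ∃ q, IsGoodResponse d q := by
  have hhalf : (1 : ℝ) / 2 ^ (v + 1) ≤ 1 / 2 ^ v :=
    one_div_pow_le_one_div_pow_of_le one_le_two v.le_succ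
  have hLT := monotone_numSlopesLT d (neg_le_neg hhalf)
  have hLE := monotone_numSlopesLE d hhalf
  have hle := numSlopesLE_le d (1 / 2 ^ v)
  obtain ⟨q, hcq, hqc, hw⟩ := exists_gridWidth_eq_two_pow hvK
    (c := min (numSlopesLT d (-(1 / 2 ^ (v + 1)))) (numSlopesLE d (1 / 2 ^ v) - 2 * 2 ^ v))
    (by omega)
  have hrate : gridRate q = 1 / 2 ^ (v + 1) := by simp [gridRate, hw, pow_succ']
  have hrate₂ : 2 * gridRate q = 1 / 2 ^ v := by rw [hrate, pow_succ']; field_simp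
  refine ⟨q, isGoodResponse_of_monotone hd ?_ (fun j hj => ?_) (fun j hj => ?_)⟩
  · rw [hrate₂, abs_le]
    refine ⟨not_lt.1 fun h => ?_, (lt_numSlopesLE_iff hd).1 (by omega)⟩
    have := (lt_numSlopesLT_iff hd).2 h
    omega
  · rw [hrate]
    exact (lt_numSlopesLT_iff hd).1 (by omega)
  · rw [hrate]
    refine not_le.1 fun h => ?_
    have := (lt_numSlopesLE_iff hd).2 h
    omega

theorem exists_isGoodResponse {K : ℕ} (hK : K ≠ 0) {d : Fin (2 ^ K) → ℝ}
    (hd : d ∈ slopeSet (2 ^ K)) : ∃ q, IsGoodResponse d q := by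
  obtain ⟨v, hvK, hv, hv'⟩ := exists_last_scale (K := K)
    (a := fun v => numSlopesLT d (-(1 / 2 ^ v))) (b := fun v => numSlopesLE d (1 / 2 ^ v))
    (by simpa [numSlopesLT_neg_one hd, numSlopesLE_one hd] using Nat.le_self_pow hK 2)
    ((numSlopesLE_le d _).trans_lt (by have := Nat.two_pow_pos K; omega))
  exact exists_isGoodResponse_of_scale hvK hd.1 hv hv'

/-! ### Drift of the exponential weights -/

section Drift

variable {n : ℕ} (q j : Fin n)

/-- The amount by which a good response `q` may lose on the cell `j` in each round, up to a factor
making up for the second order term of the exponential. -/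
noncomputable def compensation : ℝ := if j ∈ window q then 3 * gridRate q else 0

/-- The loss of the grid index `q` on the cell `j` with slope `x`, net of the compensation. -/
noncomputable def netLoss (x : ℝ) : ℝ := slopeSign q j * x - compensation q j

/-- A majorant of `Real.exp (gridRate q * netLoss q j x)` on `[-1, 1]` which is affine in `x`. -/
noncomputable def affineMajorant (x : ℝ) : ℝ :=
  Real.exp (-(gridRate q * compensation q j)) *
    (1 + gridRate q * (slopeSign q j * x) + gridRate q ^ 2)

theorem compensation_nonneg : 0 ≤ compensation q j := by
  have := gridRate_pos q
  unfold compensation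
  split_ifs <;> positivity

theorem sum_compensation_le : ∑ j, compensation q j ≤ 12 := by
  have hw : (0 : ℝ) < gridWidth q := by exact_mod_cast gridWidth_pos q
  have hr := gridRate_pos q
  calc ∑ j, compensation q j = (window q).card * (3 * gridRate q) := by
        simp only [compensation, Finset.sum_ite_mem, Finset.univ_inter, Finset.sum_const,
          nsmul_eq_mul]
    _ ≤ (8 * gridWidth q : ℕ) * (3 * gridRate q) := by
        gcongr
        exact card_window_le q
    _ = 12 := by
        rw [gridRate]
        push_cast
        field_simp
        norm_num

theorem exp_netLoss_le_affineMajorant {x : ℝ} (hx : |x| ≤ 1) :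
    Real.exp (gridRate q * netLoss q j x) ≤ affineMajorant q j x := by
  have hr := gridRate_pos q
  have habs : |gridRate q * (slopeSign q j * x)| ≤ gridRate q := by
    rw [abs_mul, abs_mul, abs_slopeSign, one_mul, abs_of_pos hr]
    exact mul_le_of_le_one_right hr.le hx
  have hexp := (abs_le.1 (Real.abs_exp_sub_one_sub_id_le (habs.trans (gridRate_le_one q)))).2
  have hsq := sq_le_sq' (abs_le.1 habs).1 (abs_le.1 habs).2
  rw [netLoss, affineMajorant, mul_sub, sub_eq_neg_add, Real.exp_add]
  exact mul_le_mul_of_nonneg_left (by linarith) (Real.exp_pos _).le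

variable {q}

theorem IsGoodResponse.affineMajorant_le_one {d : Fin n → ℝ} (h : IsGoodResponse d q) :
    affineMajorant q j (d j) ≤ 1 := by
  have hr := gridRate_pos q
  have hj := h j
  unfold affineMajorant compensation
  rw [Real.exp_neg, inv_mul_le_one₀ (Real.exp_pos _)]
  split_ifs at hj ⊢
  · refine le_trans ?_ (Real.add_one_le_exp _)
    nlinarith
  · rw [mul_zero, Real.exp_zero]
    nlinarith

theorem concaveOn_sum_affineMajorant (a : Fin n → ℝ) {D : Set (Fin n → ℝ)} (hD : Convex ℝ D) :
    ConcaveOn ℝ D fun d => ∑ j, a j * (affineMajorant q j (d j) - 1) := by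
  refine ⟨hD, fun d _ e _ s t _ _ hst => le_of_eq ?_⟩
  obtain rfl : t = 1 - s := by linarith
  simp only [smul_eq_mul, Finset.mul_sum, ← Finset.sum_add_distrib, affineMajorant, Pi.add_apply,
    Pi.smul_apply]
  exact Finset.sum_congr rfl fun j _ => by ring

end Drift

theorem exists_stdSimplex_sum_exp_netLoss_nonpos {K : ℕ} (hK : K ≠ 0)
    {a : Fin (2 ^ K) → Fin (2 ^ K) → ℝ} (ha : ∀ q j, 0 ≤ a q j) :
    ∃ ρ ∈ stdSimplex ℝ (Fin (2 ^ K)), ∀ d ∈ slopeSet (2 ^ K),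
      ∑ q, ρ q * ∑ j, a q j * (Real.exp (gridRate q * netLoss q j (d j)) - 1) ≤ 0 := by
  obtain ⟨ρ, hρ, h⟩ := exists_stdSimplex_sum_mul_nonpos (isCompact_slopeSet (2 ^ K))
    (convex_slopeSet _) (slopeSet_nonempty _)
    (L := fun d q => ∑ j, a q j * (affineMajorant q j (d j) - 1))
    (fun q => by unfold affineMajorant; fun_prop)
    (fun q => concaveOn_sum_affineMajorant (a q) (convex_slopeSet _))
    (fun d hd => by
      obtain ⟨q, hq⟩ := exists_isGoodResponse hK hd
      exact ⟨q, Finset.sum_nonpos fun j _ => mul_nonpos_of_nonneg_of_nonpos (ha q j)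
        (sub_nonpos.2 (hq.affineMajorant_le_one j))⟩)
  refine ⟨ρ, hρ, fun d hd => le_trans ?_ (h d hd)⟩
  gcongr with q _ j _
  · exact hρ.1 q
  · exact ha q j
  · exact exp_netLoss_le_affineMajorant q j (abs_le_one_of_mem_slopeSet hd j)

/-! ### Supermartingale strategies -/

section Game

variable {Y : Type*} {t : ℕ}

/-- The transcript `h` followed by a round with prediction `p` and outcome `y`. -/
def appendRound (h : Transcript Y t) (p : unitInterval) (y : Y) : Transcript Y (t + 1) :=
  Fin.snoc (α := fun _ => unitInterval × Y) h (p, y)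

/-- The transcript without rounds. -/
def emptyTranscript : Transcript Y 0 := fun i => i.elim0

theorem sum_roundsWith_appendRound (h : Transcript Y t) (p r : unitInterval) (y : Y)
    (f : unitInterval × Y → ℝ) :
    ∑ s ∈ roundsWith (fun s => (appendRound h p y s).1) r, f (appendRound h p y s) =
      ∑ s ∈ roundsWith (fun s => (h s).1) r, f (h s) + if p = r then f (p, y) else 0 := by
  rw [roundsWith, roundsWith, Finset.sum_filter, Finset.sum_filter, Fin.sum_univ_castSucc]
  simp only [appendRound, Fin.snoc_castSucc, Fin.snoc_last]

variable {ρ : PredictionStrategy Y} {G : Set unitInterval}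

theorem finite_support_transcriptLaw (hG : G.Finite) (hρ : ∀ t h, (ρ t h).support ⊆ G)
    (A : Adversary Y) (t : ℕ) : (transcriptLaw ρ A t).support.Finite := by
  induction t with
  | zero => simp [transcriptLaw]
  | succ t ih =>
    refine finite_support_bind ih fun h => ?_
    rw [PMF.support_map]
    exact (hG.subset (hρ t h)).image _

theorem prediction_mem_of_mem_support_transcriptLaw (hρ : ∀ t h, (ρ t h).support ⊆ G)
    (A : Adversary Y) {h : Transcript Y t} (hh : h ∈ (transcriptLaw ρ A t).support) (s : Fin t) :
    (h s).1 ∈ G := by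
  induction t with
  | zero => exact s.elim0
  | succ t ih =>
    obtain ⟨h₀, hh₀, hmap⟩ := (PMF.mem_support_bind_iff _ _ _).1 hh
    rw [PMF.support_map] at hmap
    obtain ⟨p, hp, rfl⟩ := hmap
    induction s using Fin.lastCases with
    | last => simpa using hρ t h₀ hp
    | cast s => simpa using ih hh₀ s

theorem PMFExpect_transcriptLaw_succ (hG : G.Finite) (hρ : ∀ t h, (ρ t h).support ⊆ G)
    (A : Adversary Y) (t : ℕ) (f : Transcript Y (t + 1) → ℝ) :
    PMFExpect (transcriptLaw ρ A (t + 1)) f = PMFExpect (transcriptLaw ρ A t) fun h =>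
      PMFExpect (ρ t h) fun p => f (appendRound h p (A t h)) := by
  have hfin : ∀ t h, (ρ t h).support.Finite := fun t h => hG.subset (hρ t h)
  rw [transcriptLaw, PMFExpect_bind (finite_support_transcriptLaw hG hρ A t) fun h => by
    rw [PMF.support_map]
    exact (hfin t h).image _]
  simp only [PMFExpect_map _ (hfin t _)]
  rfl

theorem PMFExpect_transcriptLaw_le (hG : G.Finite) (hρ : ∀ t h, (ρ t h).support ⊆ G)
    {Φ : (t : ℕ) → Transcript Y t → ℝ}
    (hΦ : ∀ t h y, PMFExpect (ρ t h) (fun p => Φ (t + 1) (appendRound h p y)) ≤ Φ t h)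
    (A : Adversary Y) (t : ℕ) :
    PMFExpect (transcriptLaw ρ A t) (Φ t) ≤ Φ 0 emptyTranscript := by
  induction t with
  | zero => exact (PMFExpect_pure _ _).le
  | succ t ih =>
    rw [PMFExpect_transcriptLaw_succ hG hρ]
    exact (PMFExpect_mono (finite_support_transcriptLaw hG hρ A t) fun h _ =>
      hΦ t h (A t h)).trans ih

theorem guaranteesCAL_of_potential {S : ℝ → Y → ℝ} {T : ℕ} (hG : G.Finite)
    (hρ : ∀ t h, (ρ t h).support ⊆ G) {Φ : (t : ℕ) → Transcript Y t → ℝ}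
    (hΦ : ∀ t h y, PMFExpect (ρ t h) (fun p => Φ (t + 1) (appendRound h p y)) ≤ Φ t h) {c : ℝ}
    (hCAL : ∀ h : Transcript Y T, (∀ s, (h s).1 ∈ G) → transcriptCAL S h ≤ c + Φ T h) :
    GuaranteesCAL S T ρ (c + Φ 0 emptyTranscript) := by
  intro A
  have hfin := finite_support_transcriptLaw hG hρ A T
  refine ⟨summable_toReal_mul_of_finite_support hfin _, ?_⟩
  calc PMFExpect (transcriptLaw ρ A T) (transcriptCAL S)
      ≤ PMFExpect (transcriptLaw ρ A T) fun h => c + Φ T h := PMFExpect_mono hfin fun h hh =>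
        hCAL h (prediction_mem_of_mem_support_transcriptLaw hρ A hh)
    _ = c + PMFExpect (transcriptLaw ρ A T) (Φ T) := PMFExpect_const_add hfin _ _
    _ ≤ c + Φ 0 emptyTranscript := by
        gcongr
        exact PMFExpect_transcriptLaw_le hG hρ hΦ A T

end Game

/-! ### The grid strategy -/

/-- The exponential weight of the grid index `q` on the cell `j`, after the rounds in `R` with
slope vectors `x`. The prefactor is chosen so that `n` times the weight bounds the total net
loss. -/
noncomputable def expWeight {ι : Type*} {n : ℕ} (x : ι → Fin n → ℝ) (R : Finset ι)
    (q j : Fin n) : ℝ :=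
  1 / (gridRate q * n) * Real.exp (gridRate q * ∑ s ∈ R, netLoss q j (x s j))

theorem expWeight_nonneg {ι : Type*} {n : ℕ} (x : ι → Fin n → ℝ) (R : Finset ι) (q j : Fin n) :
    0 ≤ expWeight x R q j := by
  have := gridRate_pos q
  unfold expWeight
  positivity

/-- The point `q / n` of the unit interval. -/
noncomputable def gridPoint {n : ℕ} (q : Fin n) : unitInterval :=
  ⟨(q : ℕ) / n, by positivity, div_le_one_of_le₀ (by exact_mod_cast q.isLt.le) (by positivity)⟩

theorem gridPoint_injective (n : ℕ) : Function.Injective (gridPoint (n := n)) := by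
  intro q r hqr
  have hn : (n : ℝ) ≠ 0 := by exact_mod_cast q.pos.ne'
  have h : ((q : ℕ) : ℝ) / n = (r : ℕ) / n := congrArg Subtype.val hqr
  rw [div_left_inj' hn] at h
  exact Fin.ext (by exact_mod_cast h)

section Potential

variable {Y : Type*} {n t : ℕ} (slope : Y → Fin n → ℝ)

/-- The exponential weight of the grid index `q` on the cell `j` after the transcript `h`: only the
rounds in which `q / n` was predicted count. -/
noncomputable def transcriptWeight (h : Transcript Y t) (q j : Fin n) : ℝ :=
  expWeight (fun s => slope (h s).2) (roundsWith (fun s => (h s).1) (gridPoint q)) q j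

/-- The total exponential weight of a transcript. -/
noncomputable def potential (h : Transcript Y t) : ℝ := ∑ q, ∑ j, transcriptWeight slope h q j

theorem transcriptWeight_appendRound (h : Transcript Y t) (p : unitInterval) (y : Y)
    (q j : Fin n) :
    transcriptWeight slope (appendRound h p y) q j = transcriptWeight slope h q j +
      if p = gridPoint q then
        transcriptWeight slope h q j * (Real.exp (gridRate q * netLoss q j (slope y j)) - 1)
      else 0 := by
  unfold transcriptWeight expWeight
  rw [sum_roundsWith_appendRound h p _ y fun r => netLoss q j (slope r.2 j)]
  split_ifs
  · rw [mul_add, Real.exp_add]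
    ring
  · simp

theorem potential_appendRound (h : Transcript Y t) (q : Fin n) (y : Y) :
    potential slope (appendRound h (gridPoint q) y) = potential slope h +
      ∑ j, transcriptWeight slope h q j *
        (Real.exp (gridRate q * netLoss q j (slope y j)) - 1) := by
  simp only [potential, transcriptWeight_appendRound, (gridPoint_injective n).eq_iff,
    Finset.sum_add_distrib]
  congr 1
  rw [Finset.sum_comm]
  simp

theorem potential_emptyTranscript :
    potential slope emptyTranscript = 2 * ∑ q : Fin n, gridWidth q := by
  unfold potential
  push_cast
  rw [Finset.mul_sum]
  refine Finset.sum_congr rfl fun q _ => ?_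
  have hn : (n : ℝ) ≠ 0 := by exact_mod_cast q.pos.ne'
  have hw : (gridWidth q : ℝ) ≠ 0 := by exact_mod_cast (gridWidth_pos q).ne'
  simp only [transcriptWeight, expWeight, roundsWith, Finset.univ_eq_empty, Finset.filter_empty,
    Finset.sum_empty, mul_zero, Real.exp_zero, Finset.sum_const, Finset.card_univ,
    Fintype.card_fin, nsmul_eq_mul, gridRate]
  field_simp

theorem exists_PMF_potential_le {K : ℕ} (hK : K ≠ 0) {slope : Y → Fin (2 ^ K) → ℝ}
    (hslope : ∀ y, slope y ∈ slopeSet (2 ^ K)) (h : Transcript Y t) :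
    ∃ ρ : PMF unitInterval, ρ.support ⊆ Set.range (gridPoint (n := 2 ^ K)) ∧
      ∀ y, PMFExpect ρ (fun p => potential slope (appendRound h p y)) ≤ potential slope h := by
  obtain ⟨ρ, hρ, hle⟩ := exists_stdSimplex_sum_exp_netLoss_nonpos hK
    (a := transcriptWeight slope h) fun q j => expWeight_nonneg _ _ q j
  refine ⟨(simplexPMF ρ hρ).map gridPoint, ?_, fun y => ?_⟩
  · rw [PMF.support_map]
    exact Set.image_subset_range _ _
  · rw [PMFExpect_map _ (Set.toFinite _)]
    simp only [Function.comp_def, potential_appendRound]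
    rw [PMFExpect_const_add (Set.toFinite _), PMFExpect_simplexPMF]
    linarith [hle (slope y) (hslope y)]

end Potential

/-! ### Regret of a grid prediction -/

section Regret

variable {ι Y : Type*} {n : ℕ}

theorem sum_slopeSign_mul_le (x : ι → Fin n → ℝ) (R : Finset ι) (q : Fin n)
    (J : Finset (Fin n)) :
    ∑ j ∈ J, ∑ s ∈ R, slopeSign q j * x s j ≤ 12 * R.card + n * ∑ j, expWeight x R q j := by
  have hr := gridRate_pos q
  have hn : (0 : ℝ) < n := by exact_mod_cast q.pos
  have hterm : ∀ j, ∑ s ∈ R, slopeSign q j * x s j ≤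
      R.card * compensation q j + n * expWeight x R q j := by
    intro j
    set u := ∑ s ∈ R, netLoss q j (x s j) with hu
    have hnet : ∑ s ∈ R, slopeSign q j * x s j = R.card * compensation q j + u := by
      simp only [hu, netLoss, Finset.sum_sub_distrib, Finset.sum_const, nsmul_eq_mul]
      ring
    have hweight : n * expWeight x R q j = Real.exp (gridRate q * u) / gridRate q := by
      rw [expWeight, ← hu]
      field_simp
    rw [hnet, hweight]
    gcongr
    rw [le_div_iff₀ hr]
    linarith [Real.add_one_le_exp (gridRate q * u)]
  calc ∑ j ∈ J, ∑ s ∈ R, slopeSign q j * x s j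
      ≤ ∑ j ∈ J, (R.card * compensation q j + n * expWeight x R q j) :=
        Finset.sum_le_sum fun j _ => hterm j
    _ ≤ ∑ j, (R.card * compensation q j + n * expWeight x R q j) :=
        Finset.sum_le_univ_sum_of_nonneg fun j => add_nonneg
          (mul_nonneg (Nat.cast_nonneg _) (compensation_nonneg q j))
          (mul_nonneg hn.le (expWeight_nonneg x R q j))
    _ = R.card * ∑ j, compensation q j + n * ∑ j, expWeight x R q j := by
        rw [Finset.sum_add_distrib, ← Finset.mul_sum, ← Finset.mul_sum]
    _ ≤ 12 * R.card + n * ∑ j, expWeight x R q j := by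
        rw [mul_comm 12]
        gcongr
        exact sum_compensation_le q

theorem sum_ite_lt_sub (f : ℕ → ℝ) {m : ℕ} (hm : m ≤ n) :
    ∑ j : Fin n, (if (j : ℕ) < m then f (j + 1) - f j else 0) = f m - f 0 := by
  rw [Fin.sum_univ_eq_sum_range fun j => if j < m then f (j + 1) - f j else 0,
    ← Finset.sum_filter, ← Finset.sum_range_sub]
  refine Finset.sum_congr ?_ fun _ _ => rfl
  ext j
  simp only [Finset.mem_filter, Finset.mem_range]
  omega

theorem sub_eq_sum_slopeSign_mul (f : ℕ → ℝ) (q : Fin n) {m : ℕ} (hm : m ≤ n) :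
    f q - f m = ∑ j : Fin n with (q ≤ j ↔ (j : ℕ) < m), slopeSign q j * (f (j + 1) - f j) := by
  calc f q - f m = (f q - f 0) - (f m - f 0) := by ring
    _ = ∑ j : Fin n, ((if (j : ℕ) < q then f (j + 1) - f j else 0) -
          if (j : ℕ) < m then f (j + 1) - f j else 0) := by
        rw [Finset.sum_sub_distrib, sum_ite_lt_sub f q.isLt.le, sum_ite_lt_sub f hm]
    _ = ∑ j : Fin n with (q ≤ j ↔ (j : ℕ) < m), slopeSign q j * (f (j + 1) - f j) := by
        rw [Finset.sum_filter]
        refine Finset.sum_congr rfl fun j _ => ?_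
        by_cases hq : q ≤ j <;> by_cases hjm : (j : ℕ) < m <;>
          simp [slopeSign, hq, hjm, not_lt.2, not_le.1]

theorem exists_abs_natCast_div_sub_le (hn : 0 < n) {r : ℝ} (hr : r ∈ Set.Icc (0 : ℝ) 1) :
    ∃ m ≤ n, |(m : ℝ) / n - r| ≤ 1 / n := by
  have hn' : (0 : ℝ) < n := by exact_mod_cast hn
  have hle : (⌊r * n⌋₊ : ℝ) ≤ r * n := Nat.floor_le (mul_nonneg hr.1 hn'.le)
  refine ⟨⌊r * n⌋₊, ?_, ?_⟩
  · exact_mod_cast hle.trans (mul_le_of_le_one_left hn'.le hr.2)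
  · rw [div_sub' hn'.ne', abs_div, abs_of_pos hn']
    gcongr
    rw [abs_le]
    constructor <;> linarith [Nat.lt_floor_add_one (r * n)]

theorem natCast_div_mem_Icc {j : ℕ} (hj : j ≤ n) : (j / n : ℝ) ∈ Set.Icc (0 : ℝ) 1 :=
  ⟨by positivity, div_le_one_of_le₀ (by exact_mod_cast hj) (by positivity)⟩

theorem natCast_succ_div_sub (n j : ℕ) : ((j + 1 : ℕ) / n - (j : ℕ) / n : ℝ) = 1 / n := by
  push_cast
  ring

theorem IsConvexLipschitzScore.abs_sub_le {S : ℝ → Y → ℝ} (hS : IsConvexLipschitzScore S) (y : Y)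
    {a b : ℝ} (ha : a ∈ Set.Icc (0 : ℝ) 1) (hb : b ∈ Set.Icc (0 : ℝ) 1) :
    |S a y - S b y| ≤ |a - b| := by
  simpa [Real.dist_eq] using (hS y).2.dist_le_mul a ha b hb

/-- The slopes of the score on the `n` cells of a uniform grid. -/
noncomputable def gridSlope (S : ℝ → Y → ℝ) (n : ℕ) (y : Y) (j : Fin n) : ℝ :=
  n * (S ((j + 1 : ℕ) / n) y - S ((j : ℕ) / n) y)

theorem IsConvexLipschitzScore.monotone_gridSlope {S : ℝ → Y → ℝ} (hS : IsConvexLipschitzScore S)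
    (n : ℕ) (y : Y) : Monotone (gridSlope S n y) := by
  obtain _ | n := n
  · exact Subsingleton.monotone _
  refine Fin.monotone_iff_le_succ.2 fun i => ?_
  have hn : (0 : ℝ) < (n + 1 : ℕ) := by positivity
  have h := (hS y).1.slope_mono_adjacent (x := (i : ℕ) / (n + 1 : ℕ))
    (y := (i + 1 : ℕ) / (n + 1 : ℕ)) (z := (i + 1 + 1 : ℕ) / (n + 1 : ℕ))
    (natCast_div_mem_Icc (by omega)) (natCast_div_mem_Icc (by omega))
    (by gcongr; omega) (by gcongr; omega)
  rw [natCast_succ_div_sub, natCast_succ_div_sub,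
    div_le_div_iff_of_pos_right (one_div_pos.2 hn)] at h
  exact mul_le_mul_of_nonneg_left h hn.le

theorem IsConvexLipschitzScore.abs_gridSlope_le {S : ℝ → Y → ℝ} (hS : IsConvexLipschitzScore S)
    (y : Y) (j : Fin n) : |gridSlope S n y j| ≤ 1 := by
  have hn : (0 : ℝ) < n := by exact_mod_cast j.pos
  have h := hS.abs_sub_le y (natCast_div_mem_Icc j.isLt) (natCast_div_mem_Icc j.isLt.le)
  rw [natCast_succ_div_sub, abs_of_pos (one_div_pos.2 hn), le_div_iff₀' hn] at h
  rwa [gridSlope, abs_mul, abs_of_pos hn]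

theorem IsConvexLipschitzScore.gridSlope_mem_slopeSet {S : ℝ → Y → ℝ}
    (hS : IsConvexLipschitzScore S) (n : ℕ) (y : Y) : gridSlope S n y ∈ slopeSet n :=
  ⟨hS.monotone_gridSlope n y, (pi_norm_le_iff_of_nonneg zero_le_one).2 (hS.abs_gridSlope_le y)⟩

theorem sum_sub_gridPoint_le (S : ℝ → Y → ℝ) (R : Finset ι) (y : ι → Y) (q : Fin n) {m : ℕ}
    (hm : m ≤ n) :
    ∑ s ∈ R, (S (gridPoint q) (y s) - S (m / n) (y s)) ≤
      12 * R.card / n + ∑ j, expWeight (fun s => gridSlope S n (y s)) R q j := by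
  have hn : (0 : ℝ) < n := by exact_mod_cast q.pos
  have hslope := sum_slopeSign_mul_le (fun s => gridSlope S n (y s)) R q
    {j | q ≤ j ↔ (j : ℕ) < m}
  have hreg : n * ∑ s ∈ R, (S (gridPoint q) (y s) - S (m / n) (y s)) =
      ∑ j with (q ≤ j ↔ (j : ℕ) < m), ∑ s ∈ R, slopeSign q j * gridSlope S n (y s) j := by
    rw [Finset.sum_comm, Finset.mul_sum]
    refine Finset.sum_congr rfl fun s _ => ?_
    have := sub_eq_sum_slopeSign_mul (fun i : ℕ => S (i / n) (y s)) q hm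
    simp only [gridSlope, mul_left_comm _ (n : ℝ), ← Finset.mul_sum]
    rw [← this]
    rfl
  rw [← hreg] at hslope
  refine le_of_mul_le_mul_left (hslope.trans_eq ?_) hn
  field_simp

theorem IsConvexLipschitzScore.sum_sub_le {S : ℝ → Y → ℝ} (hS : IsConvexLipschitzScore S)
    (R : Finset ι) (y : ι → Y) (q : Fin n) (r : unitInterval) :
    ∑ s ∈ R, (S (gridPoint q) (y s) - S r (y s)) ≤
      13 * R.card / n + ∑ j, expWeight (fun s => gridSlope S n (y s)) R q j := by
  obtain ⟨m, hmn, hmr⟩ := exists_abs_natCast_div_sub_le q.pos r.2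
  have hround : ∑ s ∈ R, (S (m / n) (y s) - S r (y s)) ≤ R.card * (1 / n) := by
    rw [← nsmul_eq_mul]
    exact Finset.sum_le_card_nsmul _ _ _ fun s _ =>
      (le_abs_self _).trans ((hS.abs_sub_le _ (natCast_div_mem_Icc hmn) r.2).trans hmr)
  calc ∑ s ∈ R, (S (gridPoint q) (y s) - S r (y s))
      = ∑ s ∈ R, (S (gridPoint q) (y s) - S (m / n) (y s)) +
          ∑ s ∈ R, (S (m / n) (y s) - S r (y s)) := by
        simp only [← Finset.sum_add_distrib, sub_add_sub_cancel]
    _ ≤ 12 * R.card / n + ∑ j, expWeight (fun s => gridSlope S n (y s)) R q j +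
          R.card * (1 / n) := add_le_add (sum_sub_gridPoint_le S R y q hmn) hround
    _ = _ := by ring

end Regret

/-! ### Calibration error -/

section Calibration

variable {Y : Type*} {S : ℝ → Y → ℝ} {T : ℕ} (p : Fin T → unitInterval) (y : Fin T → Y)

theorem PMFExpect_outcomeDist (q : unitInterval) (hq : q ∈ Finset.univ.image p) (f : Y → ℝ) :
    PMFExpect (outcomeDist p y q hq) f =
      ((roundsWith p q).card : ℝ)⁻¹ * ∑ t ∈ roundsWith p q, f (y t) := by
  rw [outcomeDist, PMFExpect_map _ (Set.toFinite _), PMFExpect_eq_sum (s := roundsWith p q)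
    fun t ht => (PMF.mem_support_uniformOfFinset_iff _ _).1 ht, Finset.mul_sum]
  refine Finset.sum_congr rfl fun t ht => ?_
  rw [PMF.uniformOfFinset_apply_of_mem _ ht, ENNReal.toReal_inv, ENNReal.toReal_natCast]
  rfl

theorem card_mul_subopt_le (q : unitInterval) (hq : q ∈ Finset.univ.image p) {B : ℝ}
    (hB : ∀ r : unitInterval, ∑ t ∈ roundsWith p q, (S q (y t) - S r (y t)) ≤ B) :
    ((roundsWith p q).card : ℝ) * subopt S (outcomeDist p y q hq) q ≤ B := by
  have hN : (0 : ℝ) < (roundsWith p q).card := by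
    exact_mod_cast (roundsWith_nonempty p hq).card_pos
  simp only [subopt, PMFExpect_outcomeDist]
  rw [← le_div_iff₀' hN, sub_le_comm]
  refine le_ciInf fun r => ?_
  have hr := hB r
  rw [Finset.sum_sub_distrib] at hr
  rw [inv_mul_eq_div, inv_mul_eq_div, ← sub_div]
  gcongr
  linarith

theorem CAL_le_sum {κ : Type*} [Fintype κ] {pos : κ → unitInterval} {B : κ → ℝ}
    (hp : ∀ t, p t ∈ Set.range pos)
    (hB : ∀ k (r : unitInterval),
      ∑ t ∈ roundsWith p (pos k), (S (pos k) (y t) - S r (y t)) ≤ B k) :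
    CAL S p y ≤ ∑ k, B k := by
  have hB₀ : ∀ k, 0 ≤ B k := fun k => by simpa using hB k (pos k)
  have himage : ∀ q : Finset.univ.image p, ∃ k, pos k = q := by
    rintro ⟨q, hq⟩
    obtain ⟨t, -, rfl⟩ := Finset.mem_image.1 hq
    exact hp t
  choose g hg using himage
  have hinj : Function.Injective g := fun q r hqr => Subtype.ext <| by rw [← hg, ← hg, hqr]
  calc CAL S p y ≤ ∑ q ∈ (Finset.univ.image p).attach, B (g q) :=
        Finset.sum_le_sum fun q _ => card_mul_subopt_le p y q q.2 fun r => by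
          simpa only [hg] using hB (g q) r
    _ = ∑ k ∈ (Finset.univ.image p).attach.map ⟨g, hinj⟩, B k :=
        (Finset.sum_map _ ⟨g, hinj⟩ B).symm
    _ ≤ ∑ k, B k := Finset.sum_le_univ_sum_of_nonneg hB₀

theorem sum_card_roundsWith_le {κ : Type*} [Fintype κ] {pos : κ → unitInterval}
    (hpos : Function.Injective pos) : ∑ k, (roundsWith p (pos k)).card ≤ T := by
  classical
  have hdisj : ((Finset.univ : Finset κ) : Set κ).PairwiseDisjoint fun k => roundsWith p (pos k) :=
    fun k _ l _ hkl => Finset.disjoint_filter.2 fun t _ hk hl => hkl (hpos (hk.symm.trans hl))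
  rw [← Finset.card_biUnion hdisj]
  exact (Finset.card_le_univ _).trans_eq (Fintype.card_fin T)

theorem transcriptCAL_le (hS : IsConvexLipschitzScore S) {n : ℕ} (h : Transcript Y T)
    (hgrid : ∀ s, (h s).1 ∈ Set.range (gridPoint (n := n))) :
    transcriptCAL S h ≤ 13 * T / n + potential (gridSlope S n) h := by
  have hcard : (∑ q : Fin n, ((roundsWith (fun t => (h t).1) (gridPoint q)).card : ℝ)) ≤ T := by
    exact_mod_cast sum_card_roundsWith_le _ (gridPoint_injective n)
  refine (CAL_le_sum _ _ hgrid fun q r => hS.sum_sub_le _ _ q r).trans ?_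
  rw [Finset.sum_add_distrib, ← Finset.sum_div, ← Finset.mul_sum]
  refine add_le_add ?_ le_rfl
  gcongr

end Calibration

section Guarantee

variable {Y : Type*} {S : ℝ → Y → ℝ} {T : ℕ}

theorem GuaranteesCAL.mono {ρ : PredictionStrategy Y} {B B' : ℝ} (h : GuaranteesCAL S T ρ B)
    (hB : B ≤ B') : GuaranteesCAL S T ρ B' :=
  fun A => ⟨(h A).1, (h A).2.trans hB⟩

theorem exists_guaranteesCAL_two_pow (hS : IsConvexLipschitzScore S) {K : ℕ} (hK : K ≠ 0)
    (T : ℕ) : ∃ ρ : PredictionStrategy Y,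
      GuaranteesCAL S T ρ (13 * T / 2 ^ K + 2 * ((K + 1) * 2 ^ K)) := by
  choose ρ hρ hΦ using fun (t : ℕ) (h : Transcript Y t) =>
    exists_PMF_potential_le hK (hS.gridSlope_mem_slopeSet (2 ^ K)) h
  have hguar := guaranteesCAL_of_potential (S := S) (T := T) (c := 13 * T / (2 ^ K : ℕ))
    (Φ := fun _ h => potential (gridSlope S (2 ^ K)) h) (Set.finite_range _) hρ hΦ
    fun h => transcriptCAL_le hS h
  refine ⟨ρ, hguar.mono ?_⟩
  rw [potential_emptyTranscript, Nat.cast_pow, Nat.cast_two]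
  gcongr
  exact_mod_cast sum_gridWidth_two_pow_le K

theorem exists_two_pow_near_sqrt {x : ℝ} (hx : 2 ≤ x) :
    ∃ K : ℕ, K ≠ 0 ∧ √x ≤ 2 ^ K ∧ (2 : ℝ) ^ K ≤ 2 * √x ∧
      (K + 1) * Real.log 2 ≤ 5 / 2 * Real.log x := by
  obtain ⟨k, hk, hk'⟩ := exists_nat_pow_near (Real.one_le_sqrt.2 (by linarith)) one_lt_two
  have hlog : k * Real.log 2 ≤ Real.log x / 2 := by
    rw [← Real.log_pow, ← Real.log_sqrt (by linarith)]
    exact Real.log_le_log (by positivity) hk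
  have hlog₂ : Real.log 2 ≤ Real.log x := Real.log_le_log two_pos hx
  refine ⟨k + 1, k.succ_ne_zero, hk'.le, ?_, ?_⟩
  · rw [pow_succ']
    gcongr
  · push_cast
    linarith

theorem exists_guaranteesCAL (hS : IsConvexLipschitzScore S) (hT : 2 ≤ T) :
    ∃ ρ : PredictionStrategy Y,
      GuaranteesCAL S T ρ (23 / Real.log 2 * Real.sqrt T * Real.log T) := by
  obtain ⟨K, hK, hlow, hupp, hlog⟩ := exists_two_pow_near_sqrt (x := T) (by exact_mod_cast hT)
  obtain ⟨ρ, hρ⟩ := exists_guaranteesCAL_two_pow hS hK T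
  refine ⟨ρ, hρ.mono ?_⟩
  have hlog₂ : 0 < Real.log 2 := Real.log_pos one_lt_two
  have hlogT : 1 ≤ Real.log T / Real.log 2 :=
    (one_le_div hlog₂).2 (Real.log_le_log two_pos (by exact_mod_cast hT))
  have hsize : (K + 1 : ℝ) ≤ 5 / 2 * (Real.log T / Real.log 2) := by
    rwa [← mul_div_assoc, le_div_iff₀ hlog₂]
  have hround : 13 * T / (2 : ℝ) ^ K ≤ 13 * √T := by
    rw [div_le_iff₀ (by positivity), mul_assoc]
    gcongr
    calc (T : ℝ) = √T * √T := (Real.mul_self_sqrt (Nat.cast_nonneg T)).symm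
      _ ≤ √T * 2 ^ K := by gcongr
  calc 13 * T / (2 : ℝ) ^ K + 2 * ((K + 1) * 2 ^ K)
      ≤ 13 * √T * (Real.log T / Real.log 2) +
          2 * (5 / 2 * (Real.log T / Real.log 2) * (2 * √T)) := by
        gcongr
        exact hround.trans (le_mul_of_one_le_right (by positivity) hlogT)
    _ = 23 / Real.log 2 * √T * Real.log T := by ring

end Guarantee

theorem isConvexLipschitzScore_medianScore : IsConvexLipschitzScore medianScore := by
  refine fun y => ⟨?_, ?_⟩
  · exact (convexOn_dist (y : ℝ) (convex_Icc 0 1)).congr fun p _ => Real.dist_eq p y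
  · exact (LipschitzWith.dist_left (y : ℝ)).lipschitzOnWith

theorem quantileScore_eq_max (q p : ℝ) (y : unitInterval) :
    quantileScore q p y = max (q * (y - p)) ((1 - q) * (p - y)) := by
  unfold quantileScore
  rcases lt_trichotomy p y with h | rfl | h
  · rw [if_pos h.le, if_neg h.not_ge, add_zero, max_eq_left]
    nlinarith
  · simp
  · rw [if_neg h.not_ge, if_pos h.le, zero_add, max_eq_right]
    nlinarith

theorem isConvexLipschitzScore_quantileScore {q : ℝ} (h₀ : 0 ≤ q) (h₁ : q ≤ 1) :
    IsConvexLipschitzScore (quantileScore q) := by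
  intro y
  simp only [quantileScore_eq_max]
  constructor
  · refine ConvexOn.sup (f := fun p => q * ((y : ℝ) - p)) (g := fun p => (1 - q) * (p - y))
      ?_ ?_ <;>
    · refine ⟨convex_Icc 0 1, fun a _ b _ s t _ _ hst => le_of_eq ?_⟩
      obtain rfl : t = 1 - s := by linarith
      simp only [smul_eq_mul]
      ring
  · refine LipschitzOnWith.of_dist_le_mul fun a _ b _ => ?_
    simp only [Real.dist_eq, NNReal.coe_one, one_mul]
    refine (abs_max_sub_max_le_max _ _ _ _).trans (max_le ?_ ?_)
    · rw [← mul_sub, sub_sub_sub_cancel_left, abs_mul, abs_of_nonneg h₀, abs_sub_comm]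
      exact mul_le_of_le_one_left (abs_nonneg _) h₁
    · rw [← mul_sub, sub_sub_sub_cancel_right, abs_mul, abs_of_nonneg (sub_nonneg.2 h₁)]
      exact mul_le_of_le_one_left (abs_nonneg _) (sub_le_self 1 h₀)

theorem mainTheorem4 :
    ∃ C : ℝ, 0 < C ∧
      (∀ (Y : Type*) (S : ℝ → Y → ℝ), IsConvexLipschitzScore S → ∀ T : ℕ, 2 ≤ T →
        ∃ ρ : PredictionStrategy Y, GuaranteesCAL S T ρ (C * Real.sqrt T * Real.log T)) ∧
      (∀ T : ℕ, 2 ≤ T →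
        ∃ ρ : PredictionStrategy unitInterval,
          GuaranteesCAL medianScore T ρ (C * Real.sqrt T * Real.log T)) ∧
      (∀ q : ℝ, 0 ≤ q → q ≤ 1 → ∀ T : ℕ, 2 ≤ T →
        ∃ ρ : PredictionStrategy unitInterval,
          GuaranteesCAL (quantileScore q) T ρ (C * Real.sqrt T * Real.log T)) :=
  ⟨23 / Real.log 2, div_pos (by norm_num) (Real.log_pos one_lt_two),
    fun _ _ hS _ hT => exists_guaranteesCAL hS hT,
    fun _ hT => exists_guaranteesCAL isConvexLipschitzScore_medianScore hT,
    fun _ h₀ h₁ _ hT => exists_guaranteesCAL (isConvexLipschitzScore_quantileScore h₀ h₁) hT⟩
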